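/- For complex $a,b,c,d,e$ put $$f(a,b,c,d,e)=\sum_{k\ge 0}\frac{(a+2e+2k+2)\,(a+e+1)_k(b+e+1)_k(c+e+1)_k(d+e+1)_k}{(e+1)_{k+1}(a-b+e+1)_{k+1}(a-c+e+1)_{k+1}(a-d+e+1)_{k+1}},$$ where $(z)_n=z(z+1)\cdots(z+n-1)$. For all $(a,b,c,d,e)$ in some neighbourhood of the origin of $\mathbb{C}^5$ the denominators do not vanish and the series converges absolutely, and $f$ is analytic at the origin. Hence, near the origin, $$f(a,b,c,d,e)=\sum_{i_1,\dots,i_5\ge 0}c(i_1,\dots,i_5)\,a^{i_1}b^{i_2}c^{i_3}d^{i_4}e^{i_5}$$ with absolute convergence, and every coefficient of this expansion satisfies: $c(i_1,\dots,i_5)$ lies in the $\mathbb{Q}$-linear span of the multiple zeta values of weight $3+i_1+\cdots+i_5$. Here the multiple zeta values of weight $w$ are the real numbers $$\zeta(s_1,\dots,s_k)=\sum_{n_1>\cdots>n_k\ge 1}\frac{1}{n_1^{s_1}\cdots n_k^{s_k}}$$ with integers $s_1\ge 2$, $s_2,\dots,s_k\ge 1$ and $s_1+\cdots+s_k=w$.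 -/

import Mathlib

open Filter Topology

/-- The multiple zeta value `ζ(s₁,…,s_k) = ∑_{n₁ > ⋯ > n_k ≥ 1} 1 / (n₁^{s₁} ⋯ n_k^{s_k})`. -/
noncomputable def mzv {k : ℕ} (s : Fin k → ℕ) : ℝ :=
  ∑' n : {n : Fin k → ℕ // StrictAnti n ∧ ∀ j, 1 ≤ n j}, ∏ j, 1 / ((n.1 j : ℝ) ^ s j)

/-- The indices of convergent multiple zeta values: positive integers, the first of which
is at least `2`. -/
def IsAdmissible {k : ℕ} (s : Fin k → ℕ) : Prop :=
  (∀ j, 1 ≤ s j) ∧ ∀ hk : 0 < k, 2 ≤ s ⟨0, hk⟩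

/-- The `ℚ`-span of all multiple zeta values of weight `w`. -/
noncomputable def mzvSpan (w : ℕ) : Submodule ℚ ℝ :=
  Submodule.span ℚ {x : ℝ | ∃ (k : ℕ) (s : Fin k → ℕ),
    IsAdmissible s ∧ ∑ j, s j = w ∧ x = mzv s}

/-- The rising factorial `(z)_n = z (z + 1) ⋯ (z + n - 1)`. -/
noncomputable def rising (z : ℂ) (n : ℕ) : ℂ := (ascPochhammer ℂ n).eval z

/-- Numerator of the `k`-th term of the very-well-poised series. -/
noncomputable def vwpNum (a b c d e : ℂ) (k : ℕ) : ℂ :=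
  (a + 2 * e + 2 * k + 2) * rising (a + e + 1) k * rising (b + e + 1) k *
    rising (c + e + 1) k * rising (d + e + 1) k

/-- Denominator of the `k`-th term of the very-well-poised series. -/
noncomputable def vwpDen (a b c d e : ℂ) (k : ℕ) : ℂ :=
  rising (e + 1) (k + 1) * rising (a - b + e + 1) (k + 1) *
    rising (a - c + e + 1) (k + 1) * rising (a - d + e + 1) (k + 1)

/-- The `k`-th term of the very-well-poised series, with `(a,b,c,d,e)` the coordinates of `x`. -/
noncomputable def vwpTerm (x : Fin 5 → ℂ) (k : ℕ) : ℂ :=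
  vwpNum (x 0) (x 1) (x 2) (x 3) (x 4) k / vwpDen (x 0) (x 1) (x 2) (x 3) (x 4) k

/-- The very-well-poised series `f(a,b,c,d,e)`. -/
noncomputable def vwpSeries (x : Fin 5 → ℂ) : ℂ := ∑' k : ℕ, vwpTerm x k

/-- `c` is a family of power series coefficients of `f` at the origin: near the origin,
`f(x) = ∑ c(i₁,…,i_m) x₁^{i₁} ⋯ x_m^{i_m}`, the sum being absolutely convergent. -/
def IsPowerSeriesExpansion {m : ℕ} (f : (Fin m → ℂ) → ℂ) (c : (Fin m → ℕ) → ℂ) : Prop :=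
  ∀ᶠ x in 𝓝 (0 : Fin m → ℂ), HasSum (fun i : Fin m → ℕ => c i * ∏ j, x j ^ i j) (f x)

/-! With n = k + 1, pulling factorials out of the rising factorials by (z+1)_k = k! ∏_{m ≤ k} (1 +
z/m) turns the general term into n⁻³ h(x/n) ∏_{m<n} g(x/m). Here g = `vwpRatio` and h = `vwpOuter`
are fixed rational functions, regular at the origin with rational Taylor coefficients, and g(0) = 1
(`vwpTerm_eq_nestedTerm`).

Because g(0) = 1, a monomial of degree d in ∏_{m<n} g(x/m) only sees the factors that contribute
positive degree. Its coefficient is therefore a rational combination of truncated multiple harmonic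
sums of weight d (`coeff_prod_shrink_mem`). The outer factor supplies n^{-(3+d')}, and summing over
n gives multiple zeta values of weight 3 + d + d' with first index at least 3
(`tsum_coeff_mem_mzvSpan`).

Analytically, on a small polydisc the absolute values of the Taylor terms of g(x/m) sum to at most 1
+ 1/m. The product over m < n is then at most n, and the n-th term is O(n⁻²) as a power series, so
the sums over n and over monomials may be exchanged (`ExpandsOn.tsum`). Uniqueness of power series
(`ExpandsOn.unique`) transfers the result to every expansion of f. -/

/-! ### Multiple harmonic sums and multiple zeta values -/

/-- The truncated multiple harmonic sum
`∑_{n ≥ n₁ > ⋯ > n_k ≥ 1} 1 / (n₁^{s₁} ⋯ n_k^{s_k})`. -/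
noncomputable def harmonicSum : {k : ℕ} → (Fin k → ℕ) → ℕ → ℝ
  | 0, _, _ => 1
  | _ + 1, s, n => ∑ m ∈ Finset.range n, harmonicSum (Fin.tail s) m / ((m : ℝ) + 1) ^ s 0

lemma harmonicSum_nonneg {k : ℕ} (s : Fin k → ℕ) (n : ℕ) : 0 ≤ harmonicSum s n := by
  induction k generalizing n with
  | zero => simp [harmonicSum]
  | succ k ih =>
    rw [harmonicSum]
    exact Finset.sum_nonneg fun m _ => div_nonneg (ih _ _) (by positivity)

/-- A crude bound suffices: inductively each of the n summands is at most 1. The linear growth is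
absorbed later by an exponent of at least 3. -/
lemma harmonicSum_le {k : ℕ} (s : Fin k → ℕ) (hs : ∀ j, 1 ≤ s j) (n : ℕ) :
    harmonicSum s n ≤ n + 1 := by
  induction k generalizing n with
  | zero => simp [harmonicSum]
  | succ k ih =>
    rw [harmonicSum]
    have : ∀ m ∈ Finset.range n,
        harmonicSum (Fin.tail s) m / ((m : ℝ) + 1) ^ s 0 ≤ 1 := by
      intro m _
      rw [div_le_one (by positivity)]
      refine (ih (Fin.tail s) (fun j => hs _) m).trans ?_
      exact le_self_pow₀ (by linarith [m.cast_nonneg (α := ℝ)]) (by have := hs 0; omega)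
    refine (Finset.sum_le_card_nsmul _ _ _ this).trans ?_
    simp

/-- The multiple harmonic sum over a set of indices, with values in `[0, ∞]`. -/
noncomputable def nestedSum {k : ℕ} (s : Fin k → ℕ) (Q : Set ℕ) : ENNReal := by
  classical exact ∑' v : Fin k → ℕ,
    if StrictAnti v ∧ (∀ j, 1 ≤ v j) ∧ ∀ j, v j ∈ Q then
      ENNReal.ofReal (∏ j, 1 / ((v j : ℝ) ^ s j)) else 0

lemma nestedSum_zero (s : Fin 0 → ℕ) (Q : Set ℕ) : nestedSum s Q = 1 := by
  simp [nestedSum, Subsingleton.strictAnti]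

lemma strictAnti_cons_iff {k : ℕ} (n : ℕ) (v : Fin k → ℕ) :
    StrictAnti (Fin.cons n v : Fin (k + 1) → ℕ) ↔ (∀ j, v j < n) ∧ StrictAnti v := by
  constructor
  · intro h
    refine ⟨fun j => ?_, fun i j hij => ?_⟩
    · simpa using h (Fin.succ_pos j)
    · simpa using h (Fin.succ_lt_succ_iff.2 hij)
  · rintro ⟨h1, h2⟩ i j hij
    induction i using Fin.cases with
    | zero =>
      induction j using Fin.cases with
      | zero => exact absurd hij (lt_irrefl _)
      | succ j => simpa using h1 j
    | succ i =>
      induction j using Fin.cases with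
      | zero => exact absurd hij (Fin.not_lt_zero _)
      | succ j => simpa using h2 (Fin.succ_lt_succ_iff.1 hij)

-- Splits off the largest index; since `Q` is a lower set, the smaller indices lie in it
-- automatically. In `ENNReal` the regrouping needs no summability.
open Classical in
lemma nestedSum_succ {k : ℕ} (s : Fin (k + 1) → ℕ) (Q : Set ℕ) (hQ : IsLowerSet Q) :
    nestedSum s Q = ∑' m : ℕ, if m + 1 ∈ Q then
      ENNReal.ofReal (1 / ((m : ℝ) + 1) ^ s 0) * nestedSum (Fin.tail s) (Set.Iio (m + 1))
        else 0 := by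
  have key : nestedSum s Q = ∑' n : ℕ, if 1 ≤ n ∧ n ∈ Q then
      ENNReal.ofReal (1 / (n : ℝ) ^ s 0) * nestedSum (Fin.tail s) (Set.Iio n) else 0 := by
    unfold nestedSum
    rw [← (Fin.consEquiv fun _ => ℕ).tsum_eq, ENNReal.tsum_prod']
    refine tsum_congr fun n => ?_
    by_cases hn : 1 ≤ n ∧ n ∈ Q
    · rw [if_pos hn, ← ENNReal.tsum_mul_left]
      refine tsum_congr fun v => ?_
      have hiff : (StrictAnti (Fin.cons n v : Fin (k + 1) → ℕ) ∧
          (∀ j, 1 ≤ (Fin.cons n v : Fin (k + 1) → ℕ) j) ∧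
          ∀ j, (Fin.cons n v : Fin (k + 1) → ℕ) j ∈ Q) ↔
          (StrictAnti v ∧ (∀ j, 1 ≤ v j) ∧ ∀ j, v j ∈ Set.Iio n) := by
        rw [strictAnti_cons_iff]
        simp only [Fin.forall_fin_succ, Fin.cons_zero, Fin.cons_succ, Set.mem_Iio]
        exact ⟨fun h => ⟨h.1.2, h.2.1.2, h.1.1⟩,
          fun h => ⟨⟨h.2.2, h.1⟩, ⟨hn.1, h.2.1⟩, hn.2, fun j => hQ (h.2.2 j).le hn.2⟩⟩
      refine (if_congr hiff rfl rfl).trans ?_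
      rw [mul_ite, mul_zero, ← ENNReal.ofReal_mul (by positivity)]
      simp only [Fin.consEquiv_apply, Fin.prod_univ_succ, Fin.cons_zero, Fin.cons_succ,
        Fin.tail]
      congr
    · rw [if_neg hn, ENNReal.tsum_eq_zero]
      intro v
      refine if_neg ?_
      rintro ⟨-, h1, h2⟩
      exact hn ⟨by simpa using h1 0, by simpa using h2 0⟩
  -- The index n = 0 contributes nothing, so the sum is shifted to n = m + 1.
  rw [key, tsum_eq_zero_add' ENNReal.summable]
  simp

lemma nestedSum_Iio {k : ℕ} (s : Fin k → ℕ) (n : ℕ) :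
    nestedSum s (Set.Iio (n + 1)) = ENNReal.ofReal (harmonicSum s n) := by
  induction k generalizing n with
  | zero => simp [nestedSum_zero, harmonicSum]
  | succ k ih =>
    rw [nestedSum_succ s _ (isLowerSet_Iio _), tsum_eq_sum (s := Finset.range n), harmonicSum,
      ENNReal.ofReal_sum_of_nonneg fun m _ => div_nonneg (harmonicSum_nonneg _ _) (by positivity)]
    · refine Finset.sum_congr rfl fun m hm => ?_
      rw [if_pos (by simpa using hm), ih, ← ENNReal.ofReal_mul (by positivity)]
      congr 1; ring
    · intro m hm
      exact if_neg (by simpa using hm)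

/-- Admissibility is not needed: a divergent real sum is 0 by convention, and so is `ENNReal.toReal
⊤`. -/
lemma mzv_eq_nestedSum {k : ℕ} (s : Fin k → ℕ) : mzv s = (nestedSum s Set.univ).toReal := by
  classical
  unfold nestedSum mzv
  rw [ENNReal.tsum_toReal_eq (fun v => by split_ifs <;> simp)]
  refine (tsum_subtype {n : Fin k → ℕ | StrictAnti n ∧ ∀ j, 1 ≤ n j}
    (fun n => ∏ j, 1 / ((n j : ℝ) ^ s j))).trans ?_
  refine tsum_congr fun v => ?_
  by_cases h : StrictAnti v ∧ ∀ j, 1 ≤ v j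
  · rw [Set.indicator_of_mem (by exact h), if_pos ⟨h.1, h.2, fun _ => trivial⟩,
      ENNReal.toReal_ofReal (Finset.prod_nonneg fun _ _ => by positivity)]
  · rw [Set.indicator_of_notMem (by exact h), if_neg fun h' => h ⟨h'.1, h'.2.1⟩]
    simp

lemma mzv_eq_tsum_harmonicSum {k : ℕ} (s : Fin (k + 1) → ℕ) :
    mzv s = ∑' m : ℕ, harmonicSum (Fin.tail s) m / ((m : ℝ) + 1) ^ s 0 := by
  rw [mzv_eq_nestedSum, nestedSum_succ s _ isLowerSet_univ, ENNReal.tsum_toReal_eq]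
  · refine tsum_congr fun m => ?_
    rw [if_pos (Set.mem_univ _), nestedSum_Iio, ← ENNReal.ofReal_mul (by positivity),
      ENNReal.toReal_ofReal (mul_nonneg (by positivity) (harmonicSum_nonneg _ _))]
    ring
  · intro m
    rw [if_pos (Set.mem_univ _), nestedSum_Iio]
    exact ENNReal.mul_ne_top ENNReal.ofReal_ne_top ENNReal.ofReal_ne_top

/-- The `ℚ`-span of the sequences of truncated multiple harmonic sums of weight `w`. -/
noncomputable def harmonicSpan (w : ℕ) : Submodule ℚ (ℕ → ℝ) :=
  Submodule.span ℚ {F | ∃ (k : ℕ) (s : Fin k → ℕ),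
    (∀ j, 1 ≤ s j) ∧ ∑ j, s j = w ∧ F = harmonicSum s}

lemma one_mem_harmonicSpan : (fun _ => 1 : ℕ → ℝ) ∈ harmonicSpan 0 :=
  Submodule.subset_span ⟨0, Fin.elim0, fun j => j.elim0, by simp, by ext; simp [harmonicSum]⟩

lemma sum_div_mem_harmonicSpan {w p : ℕ} (hp : 1 ≤ p) {F : ℕ → ℝ} (hF : F ∈ harmonicSpan w) :
    (fun n => ∑ m ∈ Finset.range n, F m / ((m : ℝ) + 1) ^ p) ∈ harmonicSpan (p + w) := by
  induction hF using Submodule.span_induction with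
  | mem F h =>
    obtain ⟨k, s, hs, rfl, rfl⟩ := h
    refine Submodule.subset_span ⟨k + 1, Fin.cons p s, ?_, ?_, ?_⟩
    · intro j
      induction j using Fin.cases with
      | zero => simpa using hp
      | succ j => simpa using hs j
    · simp [Fin.sum_univ_succ]
    · ext n; simp [harmonicSum]
  | zero =>
    convert Submodule.zero_mem (harmonicSpan (p + w)) using 1
    ext n; simp
  | add F G _ _ hF hG =>
    convert Submodule.add_mem _ hF hG using 1
    ext n; simp [add_div, Finset.sum_add_distrib]
  | smul q F _ hF =>
    convert Submodule.smul_mem _ q hF using 1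
    ext n; simp [Finset.smul_sum, Rat.smul_def, mul_div_assoc]

/-- On generators this prepends `p` to the index. Summability is carried through the induction
because additivity of `tsum` requires it. -/
lemma summable_and_tsum_mem_mzvSpan {w p : ℕ} (hp : 3 ≤ p) {F : ℕ → ℝ}
    (hF : F ∈ harmonicSpan w) :
    Summable (fun m : ℕ => F m / ((m : ℝ) + 1) ^ p) ∧
      ∑' m : ℕ, F m / ((m : ℝ) + 1) ^ p ∈ mzvSpan (p + w) := by
  induction hF using Submodule.span_induction with
  | mem F h =>
    obtain ⟨k, s, hs, rfl, rfl⟩ := h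
    constructor
    · have h2 : Summable fun m : ℕ => 1 / ((m : ℝ) + 1) ^ 2 := by
        have := (summable_nat_add_iff 1).2 (Real.summable_one_div_nat_pow.2 (by norm_num : 1 < 2))
        simpa using this
      refine h2.of_nonneg_of_le
        (fun m => div_nonneg (harmonicSum_nonneg _ _) (by positivity)) fun m => ?_
      rw [div_le_div_iff₀ (by positivity) (by positivity), one_mul]
      calc harmonicSum s m * ((m : ℝ) + 1) ^ 2 ≤ ((m : ℝ) + 1) * ((m : ℝ) + 1) ^ 2 := by
            gcongr; exact harmonicSum_le s hs m
        _ = ((m : ℝ) + 1) ^ 3 := by ring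
        _ ≤ _ := pow_le_pow_right₀ (by linarith [m.cast_nonneg (α := ℝ)]) hp
    · refine Submodule.subset_span ⟨k + 1, Fin.cons p s, ⟨?_, ?_⟩, ?_, ?_⟩
      · intro j
        induction j using Fin.cases with
        | zero => simp; omega
        | succ j => simpa using hs j
      · intro _
        change 2 ≤ (Fin.cons p s : Fin (k + 1) → ℕ) 0
        simp; omega
      · simp [Fin.sum_univ_succ]
      · rw [mzv_eq_tsum_harmonicSum]; simp
  | zero => simp [summable_zero]
  | add F G _ _ hF hG =>
    simp only [Pi.add_apply, add_div]
    exact ⟨hF.1.add hG.1, by rw [hF.1.tsum_add hG.1]; exact Submodule.add_mem _ hF.2 hG.2⟩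
  | smul q F _ hF =>
    simp only [Pi.smul_apply, Rat.smul_def, mul_div_assoc]
    refine ⟨hF.1.mul_left _, ?_⟩
    rw [tsum_mul_left, ← Rat.smul_def]
    exact Submodule.smul_mem _ q hF.2

/-! ### Coefficients of infinite products in formal power series -/

section Products
open MvPowerSeries Finset.HasAntidiagonal
variable {σ : Type*}

/-- The power series of `x ↦ g (x / (n + 1))`. -/
noncomputable def shrink (γ : MvPowerSeries σ ℚ) (n : ℕ) : MvPowerSeries σ ℚ :=
  rescale (fun _ => 1 / ((n : ℚ) + 1)) γ

lemma coeff_shrink (γ : MvPowerSeries σ ℚ) (n : ℕ) (i : σ →₀ ℕ) :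
    coeff i (shrink γ n) = coeff i γ / ((n : ℚ) + 1) ^ i.degree := by
  rw [shrink, coeff_rescale, Finsupp.prod, Finset.prod_pow_eq_pow_sum, ← Finsupp.degree_apply]
  simp; ring

/-- Coefficients of `∏_{m ≤ n} g (x / m)` are combinations of truncated multiple
harmonic sums. -/
lemma coeff_prod_shrink_mem (γ : MvPowerSeries σ ℚ) (hγ : constantCoeff γ = 1) (i : σ →₀ ℕ) :
    (fun n => ((coeff i (∏ m ∈ Finset.range n, shrink γ m) : ℚ) : ℝ)) ∈
      harmonicSpan i.degree := by
  classical
  induction hd : i.degree using Nat.strong_induction_on generalizing i with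
  | _ d ih =>
  subst hd
  set S : ℕ → MvPowerSeries σ ℚ := fun n => ∏ m ∈ Finset.range n, shrink γ m with hS
  have hstep : ∀ n, coeff i (S (n + 1)) = coeff i (S n) +
      ∑ x ∈ (antidiagonal i).erase (i, 0),
        coeff x.2 γ * (coeff x.1 (S n) / ((n : ℚ) + 1) ^ x.2.degree) := by
    intro n
    rw [hS]
    simp only [Finset.prod_range_succ]
    -- The pair `(i, 0)` uses the constant term 1 of the new factor and reproduces the old
    -- coefficient; every other pair has a first component of smaller degree.
    rw [coeff_mul, ← Finset.add_sum_erase _ _ (show (i, 0) ∈ antidiagonal i by simp)]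
    simp only [coeff_shrink]
    congr 1
    · simp [hγ]
    · refine Finset.sum_congr rfl fun x _ => by ring
  have hsum : (fun n => ((coeff i (S n) : ℚ) : ℝ)) =
      (fun _ => ((coeff i (1 : MvPowerSeries σ ℚ) : ℚ) : ℝ)) +
      ∑ x ∈ (antidiagonal i).erase (i, 0), coeff x.2 γ •
        fun n => ∑ m ∈ Finset.range n,
          ((coeff x.1 (S m) : ℚ) : ℝ) / ((m : ℝ) + 1) ^ x.2.degree := by
    ext n
    simp only [Pi.add_apply, Finset.sum_apply, Pi.smul_apply, Rat.smul_def]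
    induction n with
    | zero => simp [hS]
    | succ n ihn =>
      rw [hstep]
      push_cast
      rw [ihn, add_assoc, ← Finset.sum_add_distrib]
      simp only [Finset.sum_range_succ, mul_add]
  change (fun n => ((coeff i (S n) : ℚ) : ℝ)) ∈ _
  rw [hsum]
  refine Submodule.add_mem _ ?_ (Submodule.sum_mem _ fun x hx => Submodule.smul_mem _ _ ?_)
  · rw [coeff_one]
    split_ifs with h
    · subst h; simpa using one_mem_harmonicSpan
    · convert Submodule.zero_mem (harmonicSpan i.degree) using 1
      ext n; simp
  · rw [Finset.mem_erase, mem_antidiagonal] at hx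
    have hx2 : x.2 ≠ 0 := fun h0 => hx.1 (by
      have := hx.2
      rw [h0, add_zero] at this
      exact Prod.ext this h0)
    have hdeg : x.2.degree + x.1.degree = i.degree := by rw [← hx.2, map_add, add_comm]
    have hpos : 1 ≤ x.2.degree :=
      Nat.one_le_iff_ne_zero.2 fun h => hx2 ((Finsupp.degree_eq_zero_iff _).1 h)
    rw [← hdeg]
    exact sum_div_mem_harmonicSpan hpos (ih _ (by omega) x.1 rfl)

/-- The coefficients of `∑_{n ≥ 1} n⁻³ h(x / n) ∏_{m < n} g (x / m)` are combinations of
multiple zeta values. -/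
lemma tsum_coeff_mem_mzvSpan (γ η : MvPowerSeries σ ℚ) (hγ : constantCoeff γ = 1)
    (i : σ →₀ ℕ) :
    ∑' n : ℕ, ((coeff i (C (1 / ((n : ℚ) + 1) ^ 3) * (shrink η n *
      ∏ m ∈ Finset.range n, shrink γ m)) : ℚ) : ℝ) ∈ mzvSpan (3 + i.degree) := by
  classical
  have h : ∀ n : ℕ, ((coeff i (C (1 / ((n : ℚ) + 1) ^ 3) * (shrink η n *
      ∏ m ∈ Finset.range n, shrink γ m)) : ℚ) : ℝ) =
      ∑ x ∈ antidiagonal i, ((coeff x.1 η : ℚ) : ℝ) *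
        (((coeff x.2 (∏ m ∈ Finset.range n, shrink γ m) : ℚ) : ℝ) /
          ((n : ℝ) + 1) ^ (3 + x.1.degree)) := by
    intro n
    rw [coeff_C_mul, coeff_mul, Finset.mul_sum]
    push_cast
    refine Finset.sum_congr rfl fun x _ => ?_
    rw [coeff_shrink, pow_add]
    push_cast
    field_simp
  have key : ∀ x : (σ →₀ ℕ) × (σ →₀ ℕ), _ := fun x =>
    summable_and_tsum_mem_mzvSpan (p := 3 + x.1.degree) (by omega)
      (coeff_prod_shrink_mem γ hγ x.2)
  simp_rw [h]
  rw [Summable.tsum_finsetSum fun x _ => (key x).1.mul_left _]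
  refine Submodule.sum_mem _ fun x hx => ?_
  rw [tsum_mul_left, ← Rat.smul_def]
  refine Submodule.smul_mem _ _ ?_
  rw [← mem_antidiagonal.1 hx, map_add, ← add_assoc]
  exact (key x).2

end Products

/-! ### Exchanging dominated double sums -/

lemma summable_swap_aux {ι : Type*} {a : ℕ → ι → ℝ} {B : ℕ → ℝ} (h0 : ∀ n i, 0 ≤ a n i)
    (h1 : ∀ n, Summable (a n)) (h2 : ∀ n, ∑' i, a n i ≤ B n) (hB : Summable B) :
    Summable fun p : ℕ × ι => a p.1 p.2 :=
  (summable_prod_of_nonneg fun p => h0 p.1 p.2).2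
    ⟨h1, hB.of_nonneg_of_le (fun n => tsum_nonneg (h0 n)) h2⟩

lemma summable_swap {ι : Type*} {a : ℕ → ι → ℝ} {B : ℕ → ℝ} (h0 : ∀ n i, 0 ≤ a n i)
    (h1 : ∀ n, Summable (a n)) (h2 : ∀ n, ∑' i, a n i ≤ B n) (hB : Summable B) :
    (∀ i, Summable fun n => a n i) ∧ Summable (fun i => ∑' n, a n i) ∧
      ∑' i, ∑' n, a n i ≤ ∑' n, B n := by
  have h3 := summable_swap_aux h0 h1 h2 hB
  have h4 : Summable fun p : ι × ℕ => a p.2 p.1 := (Equiv.prodComm _ _).summable_iff.1 h3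
  refine ⟨fun i => h4.prod_factor i, h4.prod, ?_⟩
  rw [Summable.tsum_comm (f := a) h3]
  exact h3.prod.tsum_le_tsum h2 hB

lemma hasSum_swap {ι : Type*} {a : ℕ → ι → ℝ} {B : ℕ → ℝ} {u : ℕ → ι → ℂ} {v : ℕ → ℂ}
    (h0 : ∀ n i, 0 ≤ a n i) (h1 : ∀ n, Summable (a n)) (h2 : ∀ n, ∑' i, a n i ≤ B n)
    (hB : Summable B) (hu : ∀ n i, ‖u n i‖ ≤ a n i) (hv : ∀ n, HasSum (u n) (v n)) :
    HasSum (fun i => ∑' n, u n i) (∑' n, v n) := by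
  have h3 : Summable fun p : ℕ × ι => u p.1 p.2 :=
    .of_norm_bounded (summable_swap_aux h0 h1 h2 hB) fun p => hu p.1 p.2
  have h4 : Summable fun p : ι × ℕ => u p.2 p.1 := (Equiv.prodComm _ _).summable_iff.1 h3
  have h5 := h4.prod.hasSum
  rw [Summable.tsum_comm (f := u) h3] at h5
  simpa only [(hv _).tsum_eq] using h5

/-! ### Absolutely convergent power series on polydiscs -/

section Expansions
open MvPowerSeries
variable {σ : Type*} [Fintype σ]

/-- On the polydisc of radius `r` the function `g` is the sum of the power series `φ`, whose
absolute values sum to at most `B` at radius `r`. -/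
structure ExpandsOn (r B : ℝ) (φ : MvPowerSeries σ ℂ) (g : (σ → ℂ) → ℂ) : Prop where
  summable : Summable fun i : σ →₀ ℕ => ‖coeff i φ‖ * r ^ i.degree
  tsum_le : ∑' i : σ →₀ ℕ, ‖coeff i φ‖ * r ^ i.degree ≤ B
  hasSum : ∀ x : σ → ℂ, (∀ j, ‖x j‖ ≤ r) →
    HasSum (fun i : σ →₀ ℕ => coeff i φ * ∏ j, x j ^ i j) (g x)

lemma norm_monomial_le {r : ℝ} {x : σ → ℂ} (hx : ∀ j, ‖x j‖ ≤ r) (i : σ →₀ ℕ) :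
    ‖∏ j, x j ^ i j‖ ≤ r ^ i.degree := by
  rw [norm_prod, Finsupp.degree_eq_sum, ← Finset.prod_pow_eq_pow_sum]
  refine Finset.prod_le_prod (fun _ _ => norm_nonneg _) fun j _ => ?_
  rw [norm_pow]
  exact pow_le_pow_left₀ (norm_nonneg _) (hx j) _

namespace ExpandsOn
variable {r B B' : ℝ} {φ ψ : MvPowerSeries σ ℂ} {g g' : (σ → ℂ) → ℂ}

lemma bound_nonneg (hr : 0 ≤ r) (h : ExpandsOn r B φ g) : 0 ≤ B :=
  (tsum_nonneg fun _ => by positivity).trans h.tsum_le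

lemma summable_norm (h : ExpandsOn r B φ g) {x : σ → ℂ} (hx : ∀ j, ‖x j‖ ≤ r) :
    Summable fun i : σ →₀ ℕ => ‖coeff i φ * ∏ j, x j ^ i j‖ :=
  h.summable.of_nonneg_of_le (fun _ => norm_nonneg _) fun i => by
    rw [norm_mul]; gcongr; exact norm_monomial_le hx i

lemma norm_le (h : ExpandsOn r B φ g) {x : σ → ℂ} (hx : ∀ j, ‖x j‖ ≤ r) : ‖g x‖ ≤ B := by
  rw [← (h.hasSum x hx).tsum_eq]
  refine (norm_tsum_le_tsum_norm (h.summable_norm hx)).trans (le_trans ?_ h.tsum_le)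
  refine (h.summable_norm hx).tsum_le_tsum (fun i => ?_) h.summable
  rw [norm_mul]; gcongr; exact norm_monomial_le hx i

lemma congr_fun (h : ExpandsOn r B φ g) (hg : ∀ x, (∀ j, ‖x j‖ ≤ r) → g x = g' x) :
    ExpandsOn r B φ g' :=
  ⟨h.summable, h.tsum_le, fun x hx => hg x hx ▸ h.hasSum x hx⟩

lemma mono_bound (h : ExpandsOn r B φ g) (hB : B ≤ B') : ExpandsOn r B' φ g :=
  ⟨h.summable, h.tsum_le.trans hB, h.hasSum⟩

lemma const (r : ℝ) (a : ℂ) : ExpandsOn r ‖a‖ (C a) fun _ : σ → ℂ => a := by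
  classical
  have h : HasSum (fun i : σ →₀ ℕ => ‖coeff i (C a)‖ * r ^ i.degree) ‖a‖ := by
    convert hasSum_single (0 : σ →₀ ℕ) ?_ using 1
    · simp
    · intro i hi; simp [coeff_C, hi]
  refine ⟨h.summable, h.tsum_eq.le, fun x _ => ?_⟩
  convert hasSum_single (0 : σ →₀ ℕ) ?_ using 1
  · simp
  · intro i hi; simp [coeff_C, hi]

lemma coord (r : ℝ) (j : σ) : ExpandsOn r r (X j) fun x : σ → ℂ => x j := by
  classical
  have h : HasSum (fun i : σ →₀ ℕ => ‖coeff i (X j : MvPowerSeries σ ℂ)‖ * r ^ i.degree) r := by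
    convert hasSum_single (Finsupp.single j 1) ?_ using 1
    · simp
    · intro i hi; simp [coeff_X, hi]
  refine ⟨h.summable, h.tsum_eq.le, fun x _ => ?_⟩
  convert hasSum_single (Finsupp.single j 1) ?_ using 1
  · simp [Finsupp.single_apply, Finset.prod_ite_eq, pow_ite]
  · intro i hi; simp [coeff_X, hi]

lemma add (hr : 0 ≤ r) (h : ExpandsOn r B φ g) (h' : ExpandsOn r B' ψ g') :
    ExpandsOn r (B + B') (φ + ψ) fun x => g x + g' x := by
  have hle : ∀ i : σ →₀ ℕ, ‖coeff i (φ + ψ)‖ * r ^ i.degree ≤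
      ‖coeff i φ‖ * r ^ i.degree + ‖coeff i ψ‖ * r ^ i.degree := fun i => by
    rw [← add_mul, map_add]; gcongr; exact norm_add_le _ _
  have hs := (h.summable.add h'.summable).of_nonneg_of_le (fun i => by positivity) hle
  refine ⟨hs, ?_, fun x hx => ?_⟩
  · refine (hs.tsum_le_tsum hle (h.summable.add h'.summable)).trans ?_
    rw [h.summable.tsum_add h'.summable]
    exact add_le_add h.tsum_le h'.tsum_le
  · simpa [add_mul] using (h.hasSum x hx).add (h'.hasSum x hx)

lemma mul (hr : 0 ≤ r) (h : ExpandsOn r B φ g) (h' : ExpandsOn r B' ψ g') :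
    ExpandsOn r (B * B') (φ * ψ) fun x => g x * g' x := by
  classical
  have hle : ∀ i : σ →₀ ℕ, ‖coeff i (φ * ψ)‖ * r ^ i.degree ≤
      ∑ k ∈ Finset.HasAntidiagonal.antidiagonal i,
        (‖coeff k.1 φ‖ * r ^ k.1.degree) * (‖coeff k.2 ψ‖ * r ^ k.2.degree) := fun i => by
    rw [coeff_mul]
    refine (mul_le_mul_of_nonneg_right (norm_sum_le _ _) (by positivity)).trans_eq ?_
    rw [Finset.sum_mul]
    refine Finset.sum_congr rfl fun k hk => ?_
    rw [← Finset.HasAntidiagonal.mem_antidiagonal.1 hk, map_add, norm_mul, pow_add]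
    ring
  have hnn : ∀ (χ : MvPowerSeries σ ℂ) (i : σ →₀ ℕ), 0 ≤ ‖coeff i χ‖ * r ^ i.degree :=
    fun χ i => by positivity
  have hsm := h.summable.mul_of_nonneg h'.summable (hnn φ) (hnn ψ)
  have hs2 := summable_sum_mul_antidiagonal_of_summable_mul
    (f := fun i : σ →₀ ℕ => ‖coeff i φ‖ * r ^ i.degree)
    (g := fun i : σ →₀ ℕ => ‖coeff i ψ‖ * r ^ i.degree) hsm
  have hs := hs2.of_nonneg_of_le (hnn (φ * ψ)) hle
  refine ⟨hs, ?_, fun x hx => ?_⟩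
  · refine (hs.tsum_le_tsum hle hs2).trans ?_
    rw [← h.summable.tsum_mul_tsum_eq_tsum_sum_antidiagonal h'.summable hsm]
    exact mul_le_mul h.tsum_le h'.tsum_le (tsum_nonneg (hnn ψ))
      (h.bound_nonneg hr)
  · have hn := summable_mul_of_summable_norm (h.summable_norm hx) (h'.summable_norm hx)
    have hs3 := summable_sum_mul_antidiagonal_of_summable_mul
      (f := fun i : σ →₀ ℕ => coeff i φ * ∏ j, x j ^ i j)
      (g := fun i : σ →₀ ℕ => coeff i ψ * ∏ j, x j ^ i j) hn
    have ht := (h.hasSum x hx).summable.tsum_mul_tsum_eq_tsum_sum_antidiagonal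
      (h'.hasSum x hx).summable hn
    rw [(h.hasSum x hx).tsum_eq, (h'.hasSum x hx).tsum_eq] at ht
    rw [ht]
    refine hs3.hasSum.congr_fun fun i => ?_
    rw [coeff_mul, Finset.sum_mul]
    refine Finset.sum_congr rfl fun k hk => ?_
    rw [← Finset.HasAntidiagonal.mem_antidiagonal.1 hk]
    simp only [Finsupp.add_apply, pow_add, Finset.prod_mul_distrib]
    ring

lemma pow (hr : 0 ≤ r) (h : ExpandsOn r B φ g) (n : ℕ) :
    ExpandsOn r (B ^ n) (φ ^ n) fun x => g x ^ n := by
  induction n with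
  | zero => simpa using const r (1 : ℂ)
  | succ n ih => simpa only [pow_succ] using ih.mul hr h

lemma prod_range (hr : 0 ≤ r) {B : ℕ → ℝ} {φ : ℕ → MvPowerSeries σ ℂ}
    {g : ℕ → (σ → ℂ) → ℂ} (h : ∀ n, ExpandsOn r (B n) (φ n) (g n)) (n : ℕ) :
    ExpandsOn r (∏ m ∈ Finset.range n, B m) (∏ m ∈ Finset.range n, φ m)
      fun x => ∏ m ∈ Finset.range n, g m x := by
  induction n with
  | zero => simpa using const r (1 : ℂ)
  | succ n ih => simpa only [Finset.prod_range_succ] using ih.mul hr (h n)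

/-- Weierstrass' theorem in majorant form: summable bounds make the double series over n and
monomials absolutely convergent. -/
lemma tsum (hr : 0 < r) {B : ℕ → ℝ} {φ : ℕ → MvPowerSeries σ ℂ}
    {g : ℕ → (σ → ℂ) → ℂ} (h : ∀ n, ExpandsOn r (B n) (φ n) (g n)) (hB : Summable B) :
    ExpandsOn r (∑' n, B n) (fun i => ∑' n, coeff i (φ n)) fun x => ∑' n, g n x := by
  obtain ⟨h1, h2, h3⟩ := summable_swap (a := fun n i => ‖coeff i (φ n)‖ * r ^ i.degree)
    (fun n i => by positivity) (fun n => (h n).summable) (fun n => (h n).tsum_le) hB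
  have hle : ∀ i : σ →₀ ℕ, ‖∑' n, coeff i (φ n)‖ * r ^ i.degree ≤
      ∑' n, ‖coeff i (φ n)‖ * r ^ i.degree := fun i => by
    have h4 : Summable fun n => ‖coeff i (φ n)‖ :=
      (summable_mul_right_iff (f := fun n => ‖coeff i (φ n)‖) (pow_pos hr i.degree).ne').1 (h1 i)
    rw [tsum_mul_right]
    gcongr
    exact norm_tsum_le_tsum_norm h4
  have hs : Summable fun i : σ →₀ ℕ => ‖∑' n, coeff i (φ n)‖ * r ^ i.degree :=
    h2.of_nonneg_of_le (fun i => mul_nonneg (norm_nonneg _) (pow_nonneg hr.le _)) hle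
  refine ⟨hs, (hs.tsum_le_tsum hle h2).trans h3, fun x hx => ?_⟩
  have h5 := hasSum_swap (a := fun n i => ‖coeff i (φ n)‖ * r ^ i.degree)
    (u := fun n i => coeff i (φ n) * ∏ j, x j ^ i j)
    (fun n i => by positivity) (fun n => (h n).summable) (fun n => (h n).tsum_le) hB
    (fun n i => by
      rw [norm_mul]
      exact mul_le_mul_of_nonneg_left (norm_monomial_le hx i) (norm_nonneg _))
    (fun n => (h n).hasSum x hx)
  refine h5.congr_fun fun i => ?_
  rw [tsum_mul_right]
  rfl

/-- Shrinking the polydisc by `θ` shrinks the bound for the non-constant part. -/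
lemma mono (hr : 0 ≤ r) (h : ExpandsOn r B φ g) {θ : ℝ} (h0 : 0 ≤ θ) (h1 : θ ≤ 1) :
    ExpandsOn (θ * r) (‖constantCoeff φ‖ + θ * B) φ g := by
  classical
  have hle : ∀ i : σ →₀ ℕ, ‖coeff i φ‖ * (θ * r) ^ i.degree ≤
      (if i = 0 then ‖constantCoeff φ‖ else 0) + θ * (‖coeff i φ‖ * r ^ i.degree) := fun i => by
    split_ifs with hi
    · subst hi
      have : 0 ≤ θ * ‖coeff (0 : σ →₀ ℕ) φ‖ := by positivity
      simpa using this
    · have hd : i.degree ≠ 0 := fun hd => hi ((Finsupp.degree_eq_zero_iff _).1 hd)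
      rw [mul_pow, zero_add]
      calc ‖coeff i φ‖ * (θ ^ i.degree * r ^ i.degree)
          ≤ ‖coeff i φ‖ * (θ * r ^ i.degree) := by
            gcongr
            exact pow_le_of_le_one h0 h1 hd
        _ = _ := by ring
  have hs1 : HasSum (fun i : σ →₀ ℕ => if i = 0 then ‖constantCoeff φ‖ else 0)
      ‖constantCoeff φ‖ := hasSum_ite_eq 0 _
  have hs2 := hs1.summable.add (h.summable.mul_left θ)
  have hs := hs2.of_nonneg_of_le (fun i => by positivity) hle
  refine ⟨hs, ?_, fun x hx => h.hasSum x fun j => (hx j).trans (mul_le_of_le_one_left hr h1)⟩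
  refine (hs.tsum_le_tsum hle hs2).trans ?_
  rw [hs1.summable.tsum_add (h.summable.mul_left θ), hs1.tsum_eq, tsum_mul_left]
  gcongr
  exact h.tsum_le

lemma rescale {θ : ℝ} (h0 : 0 ≤ θ) (h : ExpandsOn (θ * r) B φ g) :
    ExpandsOn r B (MvPowerSeries.rescale (fun _ => (θ : ℂ)) φ) fun x => g fun j => θ * x j := by
  have hc : ∀ i : σ →₀ ℕ, coeff i (MvPowerSeries.rescale (fun _ => (θ : ℂ)) φ) =
      θ ^ i.degree * coeff i φ := fun i => by
    rw [coeff_rescale, Finsupp.prod, Finset.prod_pow_eq_pow_sum, ← Finsupp.degree_apply]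
  have he : ∀ i : σ →₀ ℕ,
      ‖coeff i (MvPowerSeries.rescale (fun _ => (θ : ℂ)) φ)‖ * r ^ i.degree =
      ‖coeff i φ‖ * (θ * r) ^ i.degree := fun i => by
    rw [hc, norm_mul, norm_pow, Complex.norm_real, Real.norm_of_nonneg h0]
    ring
  refine ⟨by simpa only [he] using h.summable, by simpa only [he] using h.tsum_le,
    fun x hx => ?_⟩
  have := h.hasSum (fun j => θ * x j) fun j => by
    rw [norm_mul, Complex.norm_real, Real.norm_of_nonneg h0]
    exact mul_le_mul_of_nonneg_left (hx j) h0
  convert this using 2 with i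
  rw [hc]
  simp only [mul_pow, Finset.prod_mul_distrib, Finset.prod_pow_eq_pow_sum,
    Finsupp.degree_eq_sum]
  ring

/-- The multilinear form with diagonal `x ↦ ∏ j, x j ^ i j`. -/
lemma _root_.exists_multilinear_monomial (N : ℕ) (i : σ →₀ ℕ) :
    ∃ M : ContinuousMultilinearMap ℂ (fun _ : Fin N => σ → ℂ) ℂ,
      ‖M‖ ≤ 1 ∧ (i.degree = N → ∀ x, (M fun _ => x) = ∏ j, x j ^ i j) := by
  by_cases h : i.degree = N
  -- Assign `i j` of the `N` slots to the coordinate `j`; the form multiplies the coordinates so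
  -- chosen.
  · have e : Fin N ≃ Σ j, Fin (i j) := (Fintype.equivFinOfCardEq (by
      rw [Fintype.card_sigma]; simpa [Finsupp.degree_eq_sum] using h)).symm
    refine ⟨(ContinuousMultilinearMap.mkPiAlgebra ℂ (Fin N) ℂ).compContinuousLinearMap
      (fun k => ContinuousLinearMap.proj (e k).1), ?_, fun _ x => ?_⟩
    · refine ContinuousMultilinearMap.opNorm_le_bound zero_le_one fun m => ?_
      simp only [ContinuousMultilinearMap.compContinuousLinearMap_apply,
        ContinuousMultilinearMap.mkPiAlgebra_apply, ContinuousLinearMap.proj_apply, one_mul,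
        norm_prod]
      exact Finset.prod_le_prod (fun _ _ => norm_nonneg _) fun k _ => norm_le_pi_norm _ _
    · simp only [ContinuousMultilinearMap.compContinuousLinearMap_apply,
        ContinuousMultilinearMap.mkPiAlgebra_apply, ContinuousLinearMap.proj_apply]
      rw [e.prod_comp fun y : Σ j, Fin (i j) => x y.1, Fintype.prod_sigma]
      simp
  · exact ⟨0, by simp, fun h' => absurd h' h⟩

/-- Grouping monomials by total degree gives the homogeneous parts required by
`FormalMultilinearSeries`; `M N i` has norm at most 1, so the majorant controls the radius. -/
lemma exists_hasFPowerSeriesOnBall [DecidableEq σ] (hr : 0 < r) (h : ExpandsOn r B φ g) :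
    ∃ p : FormalMultilinearSeries ℂ (σ → ℂ) ℂ,
      HasFPowerSeriesOnBall g p 0 (ENNReal.ofReal r) ∧
      ∀ N x, (p N fun _ => x) =
        ∑ i ∈ Finset.finsuppAntidiag Finset.univ N, coeff i φ * ∏ j, x j ^ i j := by
  choose M hM1 hM2 using fun N => exists_multilinear_monomial (σ := σ) N
  have hmem : ∀ N (i : σ →₀ ℕ),
      i ∈ Finset.finsuppAntidiag Finset.univ N ↔ i.degree = N := fun N i => by
    simp [Finset.mem_finsuppAntidiag, Finsupp.degree_eq_sum]
  have hpre : ∀ N : ℕ, (Finsupp.degree ⁻¹' {N} : Set (σ →₀ ℕ)) =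
      ↑(Finset.finsuppAntidiag (Finset.univ : Finset σ) N) := fun N => by
    ext i; simp only [Set.mem_preimage, Set.mem_singleton_iff, Finset.mem_coe, hmem]
  have hfib : ∀ {E : Type} [NormedAddCommGroup E] (u : (σ →₀ ℕ) → E) (N : ℕ),
      ∑' i : (Finsupp.degree ⁻¹' {N} : Set (σ →₀ ℕ)), u i =
      ∑ i ∈ Finset.finsuppAntidiag Finset.univ N, u i := fun u N => by
    rw [hpre, Finset.tsum_subtype']
  let p : FormalMultilinearSeries ℂ (σ → ℂ) ℂ := fun N =>
    ∑ i ∈ Finset.finsuppAntidiag Finset.univ N, coeff i φ • M N i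
  have hp : ∀ N x, (p N fun _ => x) =
      ∑ i ∈ Finset.finsuppAntidiag Finset.univ N, coeff i φ * ∏ j, x j ^ i j := fun N x => by
    simp only [p, _root_.sum_apply, _root_.smul_apply,
      smul_eq_mul]
    refine Finset.sum_congr rfl fun i hi => ?_
    rw [hM2 N i ((hmem N i).1 hi)]
  refine ⟨p, ⟨?_, by simpa using hr, fun {y} hy => ?_⟩, hp⟩
  · refine p.le_radius_of_summable ?_
    have hs := (h.summable.hasSum.tsum_fiberwise Finsupp.degree).summable
    refine hs.of_nonneg_of_le (fun _ => by positivity) fun N => ?_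
    rw [hfib (fun i : σ →₀ ℕ => ‖coeff i φ‖ * r ^ i.degree), Real.coe_toNNReal _ hr.le]
    refine (mul_le_mul_of_nonneg_right (norm_sum_le _ _) (by positivity)).trans ?_
    rw [Finset.sum_mul]
    refine Finset.sum_le_sum fun i hi => ?_
    rw [(hmem N i).1 hi, norm_smul]
    gcongr
    exact mul_le_of_le_one_right (norm_nonneg _) (hM1 N i)
  · have hy' : ‖y‖ < r := by
      rw [Metric.mem_eball, edist_zero_right, ← ofReal_norm] at hy
      exact (ENNReal.ofReal_lt_ofReal_iff hr).1 hy
    have := (h.hasSum y fun j => (norm_le_pi_norm y j).trans hy'.le).tsum_fiberwise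
      Finsupp.degree
    rw [zero_add]
    convert this using 2 with N
    rw [hp, hfib fun i : σ →₀ ℕ => coeff i φ * ∏ j, y j ^ i j]

lemma analyticAt (hr : 0 < r) (h : ExpandsOn r B φ g) : AnalyticAt ℂ g 0 := by
  classical
  obtain ⟨p, hp, -⟩ := h.exists_hasFPowerSeriesOnBall hr
  exact hp.analyticAt

/-- The difference of the two expansions represents 0, so each of its homogeneous parts vanishes as
a function, hence as a polynomial because ℂ is infinite. -/
lemma unique {r' : ℝ} (hr : 0 < r) (hr' : 0 < r') (h : ExpandsOn r B φ g)
    (h' : ExpandsOn r' B' ψ g) : φ = ψ := by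
  classical
  obtain ⟨p, hp, hp'⟩ := h.exists_hasFPowerSeriesOnBall hr
  obtain ⟨q, hq, hq'⟩ := h'.exists_hasFPowerSeriesOnBall hr'
  have h0 : HasFPowerSeriesAt 0 (p - q) (0 : σ → ℂ) := by
    simpa using hp.hasFPowerSeriesAt.sub hq.hasFPowerSeriesAt
  ext i
  set P : MvPolynomial σ ℂ := ∑ k ∈ Finset.finsuppAntidiag Finset.univ i.degree,
    MvPolynomial.monomial k (coeff k φ - coeff k ψ) with hP
  have hP0 : P = 0 := by
    refine MvPolynomial.funext fun x => ?_
    have := h0.apply_eq_zero i.degree x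
    have h2 : ((p - q) i.degree fun _ => x) =
      (p i.degree fun _ => x) - (q i.degree fun _ => x) := rfl
    rw [h2, hp', hq', ← Finset.sum_sub_distrib] at this
    rw [hP, map_sum, map_zero, ← this]
    refine Finset.sum_congr rfl fun k _ => ?_
    rw [MvPolynomial.eval_monomial, Finsupp.prod_fintype _ _ fun _ => pow_zero _]
    ring
  have hc := congrArg (MvPolynomial.coeff i) hP0
  rw [hP, MvPolynomial.coeff_sum, Finset.sum_eq_single i] at hc
  · simpa [sub_eq_zero] using hc
  · intro k _ hk
    rw [MvPolynomial.coeff_monomial, if_neg hk]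
  · intro hi
    exact absurd (by simp [Finset.mem_finsuppAntidiag, Finsupp.degree_eq_sum]) hi

end ExpandsOn

end Expansions

/-! ### Functions with rational Taylor coefficients -/

section RationalExpansions
open MvPowerSeries
variable {σ : Type*}

lemma coeff_pow_eq_zero {R : Type*} [CommRing R] {γ : MvPowerSeries σ R}
    (hγ : constantCoeff γ = 0) {i : σ →₀ ℕ} {k : ℕ} (hk : i.degree < k) :
    coeff i (γ ^ k) = 0 := by
  refine coeff_of_lt_order (lt_of_lt_of_le ?_ (le_order_pow_of_constantCoeff_eq_zero k hγ))
  exact_mod_cast hk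

lemma map_shrink (γ : MvPowerSeries σ ℚ) (n : ℕ) :
    map (algebraMap ℚ ℂ) (shrink γ n) =
      rescale (fun _ => ((1 / ((n : ℝ) + 1) : ℝ) : ℂ)) (map (algebraMap ℚ ℂ) γ) := by
  ext i
  rw [coeff_map, coeff_shrink, coeff_rescale, coeff_map, Finsupp.prod,
    Finset.prod_pow_eq_pow_sum, ← Finsupp.degree_apply]
  simp; ring

variable [Fintype σ]

/-- Near the origin `g` is the sum of a power series with rational coefficients and
constant term `q`. -/
def HasRationalExpansion (q : ℚ) (g : (σ → ℂ) → ℂ) : Prop :=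
  ∃ γ : MvPowerSeries σ ℚ, constantCoeff γ = q ∧ ∃ r > 0, ∃ B : ℝ,
    ExpandsOn r B (map (algebraMap ℚ ℂ) γ) g

lemma ExpandsOn.restrict {r r' B : ℝ} {φ : MvPowerSeries σ ℂ} {g : (σ → ℂ) → ℂ}
    (h : ExpandsOn r B φ g) (hr' : 0 < r') (hle : r' ≤ r) : ExpandsOn r' B φ g := by
  have hl : ∀ i : σ →₀ ℕ, ‖coeff i φ‖ * r' ^ i.degree ≤ ‖coeff i φ‖ * r ^ i.degree :=
    fun i => by gcongr
  have hs := h.summable.of_nonneg_of_le (fun i => by positivity) hl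
  exact ⟨hs, (hs.tsum_le_tsum hl h.summable).trans h.tsum_le,
    fun x hx => h.hasSum x fun j => (hx j).trans hle⟩

namespace HasRationalExpansion
variable {p q : ℚ} {f g : (σ → ℂ) → ℂ}

lemma const (q : ℚ) : HasRationalExpansion q fun _ : σ → ℂ => (q : ℂ) :=
  ⟨C q, by simp, 1, one_pos, _, by simpa using ExpandsOn.const 1 (q : ℂ)⟩

lemma coord (j : σ) : HasRationalExpansion 0 fun x : σ → ℂ => x j :=
  ⟨X j, by simp, 1, one_pos, _, by simpa using ExpandsOn.coord 1 j⟩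

lemma add (hf : HasRationalExpansion p f) (hg : HasRationalExpansion q g) :
    HasRationalExpansion (p + q) fun x => f x + g x := by
  obtain ⟨φ, rfl, r, hr, B, h⟩ := hf
  obtain ⟨ψ, rfl, r', hr', B', h'⟩ := hg
  have hm := lt_min hr hr'
  refine ⟨φ + ψ, map_add _ _ _, _, hm, B + B', ?_⟩
  rw [map_add]
  exact (h.restrict hm (min_le_left _ _)).add hm.le (h'.restrict hm (min_le_right _ _))

lemma mul (hf : HasRationalExpansion p f) (hg : HasRationalExpansion q g) :
    HasRationalExpansion (p * q) fun x => f x * g x := by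
  obtain ⟨φ, rfl, r, hr, B, h⟩ := hf
  obtain ⟨ψ, rfl, r', hr', B', h'⟩ := hg
  have hm := lt_min hr hr'
  refine ⟨φ * ψ, map_mul _ _ _, _, hm, B * B', ?_⟩
  rw [map_mul]
  exact (h.restrict hm (min_le_left _ _)).mul hm.le (h'.restrict hm (min_le_right _ _))

lemma sub (hf : HasRationalExpansion p f) (hg : HasRationalExpansion q g) :
    HasRationalExpansion (p - q) fun x => f x - g x := by
  simpa [sub_eq_add_neg] using hf.add ((const (-1)).mul hg)

/-- Geometric series, on a polydisc small enough that the majorant of `f` is at most 1/2. -/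
lemma inv_one_sub (hf : HasRationalExpansion 0 f) :
    HasRationalExpansion 1 fun x => (1 - f x)⁻¹ := by
  obtain ⟨γ, hγ, r, hr, B, h⟩ := hf
  have hB := h.bound_nonneg hr.le
  set θ : ℝ := 1 / (2 * (B + 1)) with hθ
  have hθ0 : 0 < θ := by positivity
  have hθ1 : θ ≤ 1 := by
    rw [hθ, div_le_one (by positivity)]; linarith
  have hb : θ * B ≤ 1 / 2 := by
    rw [hθ, div_mul_eq_mul_div, div_le_div_iff₀ (by positivity) (by positivity)]; linarith
  have h' : ExpandsOn (θ * r) (1 / 2) (map (algebraMap ℚ ℂ) γ) f :=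
    (h.mono hr.le hθ0.le hθ1).mono_bound (by simpa [hγ] using hb)
  have hr' : 0 < θ * r := by positivity
  have hsum := ExpandsOn.tsum hr' (fun k => h'.pow hr'.le k)
    (summable_geometric_of_lt_one (by norm_num) (by norm_num))
  -- Powers `γ ^ k` with k > deg i do not reach the monomial `i`, so the sum is finite and stays
  -- rational.
  let γ' : MvPowerSeries σ ℚ := fun i => ∑ k ∈ Finset.range (i.degree + 1), coeff i (γ ^ k)
  have hγ' : ∀ i, coeff i γ' = ∑ k ∈ Finset.range (i.degree + 1), coeff i (γ ^ k) :=
    fun i => rfl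
  refine ⟨γ', ?_, _, hr', ∑' k : ℕ, (1 / 2 : ℝ) ^ k, ?_⟩
  · rw [← coeff_zero_eq_constantCoeff_apply, hγ']
    simp
  · have he : map (algebraMap ℚ ℂ) γ' =
        fun i => ∑' k, coeff i (map (algebraMap ℚ ℂ) γ ^ k) := by
      ext i
      rw [coeff_map, hγ', map_sum]
      change _ = ∑' k, coeff i (map (algebraMap ℚ ℂ) γ ^ k)
      rw [tsum_eq_sum (s := Finset.range (i.degree + 1))]
      · refine Finset.sum_congr rfl fun k _ => ?_
        rw [← map_pow, coeff_map]
      · intro k hk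
        rw [← map_pow, coeff_map, coeff_pow_eq_zero hγ (by simpa using hk), map_zero]
    rw [he]
    refine hsum.congr_fun fun x hx => tsum_geometric_of_norm_lt_one ?_
    exact (h'.norm_le hx).trans_lt (by norm_num)

lemma inv_one_add (hf : HasRationalExpansion 0 f) :
    HasRationalExpansion 1 fun x => (1 + f x)⁻¹ := by
  have h : HasRationalExpansion 0 fun x => -f x := by simpa using (const 0).sub hf
  simpa using h.inv_one_sub

end HasRationalExpansion

/-! ### Nested series with multiple zeta coefficients -/

lemma prod_one_add_inv (n : ℕ) :
    ∏ m ∈ Finset.range n, (1 + 1 / ((m : ℝ) + 1)) = n + 1 := by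
  induction n with
  | zero => simp
  | succ n ih =>
    rw [Finset.prod_range_succ, ih]
    push_cast
    field_simp

/-- The function `x ↦ n⁻³ h (x / n) ∏_{m < n} g (x / m)`, with `n + 1` in place of `n`. -/
noncomputable def nestedTerm (g h : (σ → ℂ) → ℂ) (x : σ → ℂ) (n : ℕ) : ℂ :=
  ((1 / ((n : ℚ) + 1) ^ 3 : ℚ) : ℂ) * ((h fun j => ((1 / ((n : ℝ) + 1) : ℝ) : ℂ) * x j) *
    ∏ m ∈ Finset.range n, g fun j => ((1 / ((m : ℝ) + 1) : ℝ) : ℂ) * x j)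

/-- The series `∑_{n ≥ 1} n⁻³ h (x / n) ∏_{m < n} g (x / m)` converges near the origin, and has
multiple zeta values as coefficients. -/
theorem exists_expandsOn_tsum_nestedTerm {q : ℚ} {g h : (σ → ℂ) → ℂ}
    (hg : HasRationalExpansion 1 g) (hh : HasRationalExpansion q h) :
    ∃ r > 0, ∃ (B : ℝ) (φ : MvPowerSeries σ ℂ),
      ExpandsOn r B φ (fun x => ∑' n, nestedTerm g h x n) ∧
      (∀ x : σ → ℂ, (∀ j, ‖x j‖ ≤ r) → Summable (nestedTerm g h x)) ∧
      ∀ i : σ →₀ ℕ, ∃ s ∈ mzvSpan (3 + i.degree), coeff i φ = (s : ℂ) := by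
  obtain ⟨γ, hγ, r₁, hr₁, B, hB⟩ := hg
  obtain ⟨η, -, r₂, hr₂, D, hD⟩ := hh
  have hr₃ := lt_min hr₁ hr₂
  have hB' := hB.restrict hr₃ (min_le_left _ _)
  have hD' := hD.restrict hr₃ (min_le_right _ _)
  set r₃ := min r₁ r₂
  have hB0 := hB'.bound_nonneg hr₃.le
  have hD0 := hD'.bound_nonneg hr₃.le
  -- One radius must serve all n: the choice gives `κ * B ≤ 1`, so on radius `κ * r₃ / (n + 1)` the
  -- non-constant part of `g` is bounded by `1 / (n + 1)`.
  set κ : ℝ := 1 / (B + 1) with hκ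
  have hκ0 : 0 < κ := by positivity
  have hκ1 : κ ≤ 1 := by rw [hκ, div_le_one (by positivity)]; linarith
  have hκB : κ * B ≤ 1 := by
    rw [hκ, div_mul_eq_mul_div, div_le_one (by positivity)]; linarith
  have hr : 0 < κ * r₃ := by positivity
  have hθ0 : ∀ n : ℕ, 0 < 1 / ((n : ℝ) + 1) := fun n => by positivity
  have hθ1 : ∀ n : ℕ, 1 / ((n : ℝ) + 1) ≤ 1 := fun n => by
    rw [div_le_one (by positivity)]; linarith [n.cast_nonneg (α := ℝ)]
  have hgn : ∀ n : ℕ, ExpandsOn (κ * r₃) (1 + 1 / ((n : ℝ) + 1))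
      (map (algebraMap ℚ ℂ) (shrink γ n))
      (fun x => g fun j => ((1 / ((n : ℝ) + 1) : ℝ) : ℂ) * x j) := fun n => by
    rw [map_shrink]
    refine ExpandsOn.rescale (hθ0 n).le ?_
    rw [← mul_assoc]
    refine (hB'.mono hr₃.le (by positivity) (mul_le_one₀ (hθ1 n) hκ0.le hκ1)).mono_bound ?_
    rw [constantCoeff_map, hγ, map_one, norm_one, mul_assoc]
    gcongr
    exact mul_le_of_le_one_right (hθ0 n).le hκB
  have hhn : ∀ n : ℕ, ExpandsOn (κ * r₃) D (map (algebraMap ℚ ℂ) (shrink η n))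
      (fun x => h fun j => ((1 / ((n : ℝ) + 1) : ℝ) : ℂ) * x j) := fun n => by
    rw [map_shrink]
    refine ExpandsOn.rescale (hθ0 n).le (hD'.restrict (by positivity) ?_)
    rw [← mul_assoc]
    exact mul_le_of_le_one_left hr₃.le (mul_le_one₀ (hθ1 n) hκ0.le hκ1)
  have hT : ∀ n : ℕ, ExpandsOn (κ * r₃) (D * (1 / ((n : ℝ) + 1) ^ 2))
      (map (algebraMap ℚ ℂ) (C (1 / ((n : ℚ) + 1) ^ 3) * (shrink η n *
        ∏ m ∈ Finset.range n, shrink γ m)))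
      (fun x => nestedTerm g h x n) := fun n => by
    have h1 := (hhn n).mul hr.le (ExpandsOn.prod_range hr.le hgn n)
    have h2 := (ExpandsOn.const (σ := σ) (κ * r₃) ((1 / ((n : ℚ) + 1) ^ 3 : ℚ) : ℂ)).mul hr.le h1
    rw [map_mul, map_mul, map_prod, map_C]
    refine h2.mono_bound (le_of_eq ?_)
    -- The product of the bounds telescopes to n + 1, which costs one of the three powers of 1 / (n
    -- + 1).
    rw [prod_one_add_inv]
    have : ‖((1 / ((n : ℚ) + 1) ^ 3 : ℚ) : ℂ)‖ = 1 / ((n : ℝ) + 1) ^ 3 := by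
      rw [← Complex.ofReal_ratCast, Complex.norm_real]
      push_cast
      rw [Real.norm_of_nonneg (by positivity)]
    rw [this]
    field_simp
  have hsum : Summable fun n : ℕ => D * (1 / ((n : ℝ) + 1) ^ 2) := by
    have := (summable_nat_add_iff 1).2 (Real.summable_one_div_nat_pow.2 (by norm_num : 1 < 2))
    exact Summable.mul_left D (by simpa using this)
  refine ⟨_, hr, _, _, ExpandsOn.tsum hr hT hsum, fun x hx => ?_, fun i => ?_⟩
  · exact .of_norm_bounded hsum fun n => (hT n).norm_le hx
  · refine ⟨_, tsum_coeff_mem_mzvSpan γ η hγ i, ?_⟩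
    rw [Complex.ofReal_tsum]
    refine tsum_congr fun n => ?_
    rw [coeff_map]
    simp

end RationalExpansions

/-! ### Pointwise expansions and expansions on polydiscs -/

lemma isPowerSeriesExpansion_of_expandsOn {m : ℕ} {r B : ℝ} (hr : 0 < r)
    {φ : MvPowerSeries (Fin m) ℂ} {f : (Fin m → ℂ) → ℂ} (h : ExpandsOn r B φ f) :
    IsPowerSeriesExpansion f fun i => MvPowerSeries.coeff (Finsupp.equivFunOnFinite.symm i) φ := by
  filter_upwards [Metric.ball_mem_nhds (0 : Fin m → ℂ) hr] with x hx
  rw [mem_ball_zero_iff] at hx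
  have := h.hasSum x fun j => (norm_le_pi_norm x j).trans hx.le
  rw [← Finsupp.equivFunOnFinite.symm.hasSum_iff] at this
  exact this

lemma IsPowerSeriesExpansion.exists_expandsOn {m : ℕ} {f : (Fin m → ℂ) → ℂ}
    {c : (Fin m → ℕ) → ℂ} (h : IsPowerSeriesExpansion f c) :
    ∃ r > 0, ∃ B, ExpandsOn r B (fun i : Fin m →₀ ℕ => c i) f := by
  obtain ⟨ε, hε, hball⟩ := Metric.eventually_nhds_iff.1 h
  have hs : ∀ x : Fin m → ℂ, (∀ j, ‖x j‖ ≤ ε / 2) →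
      HasSum (fun i : Fin m →₀ ℕ => c i * ∏ j, x j ^ i j) (f x) := fun x hx => by
    have hx' : dist x 0 < ε := by
      rw [dist_zero_right]
      exact ((pi_norm_le_iff_of_nonneg (by positivity)).2 hx).trans_lt (by linarith)
    have := hball hx'
    rw [← Finsupp.equivFunOnFinite.hasSum_iff] at this
    exact this
  refine ⟨ε / 2, by positivity, _, ?_, le_rfl, hs⟩
  -- Convergence at the corner (ε/2, …, ε/2) is absolute, and there every monomial attains its
  -- largest absolute value on the polydisc.
  have h1 := (hs (fun _ => ((ε / 2 : ℝ) : ℂ)) fun j => by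
    rw [Complex.norm_real, Real.norm_of_nonneg (by positivity)]).summable.norm
  refine h1.congr fun i => ?_
  rw [norm_mul, Finset.prod_pow_eq_pow_sum, ← Finsupp.degree_eq_sum, norm_pow,
    Complex.norm_real, Real.norm_of_nonneg (by positivity)]
  rfl

/-! ### The very-well-poised series -/

/-- The ratio of consecutive rising factorials in the very-well-poised series. -/
noncomputable def vwpRatio (x : Fin 5 → ℂ) : ℂ :=
  (1 + (x 0 + x 4)) * (1 + (x 1 + x 4)) * (1 + (x 2 + x 4)) * (1 + (x 3 + x 4)) *
    ((1 + x 4)⁻¹ * (1 + (x 0 - x 1 + x 4))⁻¹ * (1 + (x 0 - x 2 + x 4))⁻¹ *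
      (1 + (x 0 - x 3 + x 4))⁻¹)

/-- The outer factor of the very-well-poised series. -/
noncomputable def vwpOuter (x : Fin 5 → ℂ) : ℂ :=
  (2 + (x 0 + 2 * x 4)) *
    ((1 + x 4)⁻¹ * (1 + (x 0 - x 1 + x 4))⁻¹ * (1 + (x 0 - x 2 + x 4))⁻¹ *
      (1 + (x 0 - x 3 + x 4))⁻¹)

lemma hasRationalExpansion_vwpDenominator :
    HasRationalExpansion 1 fun x : Fin 5 → ℂ =>
      (1 + x 4)⁻¹ * (1 + (x 0 - x 1 + x 4))⁻¹ * (1 + (x 0 - x 2 + x 4))⁻¹ *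
        (1 + (x 0 - x 3 + x 4))⁻¹ := by
  have X (j : Fin 5) := HasRationalExpansion.coord j
  have D (j : Fin 5) : HasRationalExpansion 1 fun x : Fin 5 → ℂ => (1 + (x 0 - x j + x 4))⁻¹ :=
    HasRationalExpansion.inv_one_add (by simpa using ((X 0).sub (X j)).add (X 4))
  simpa using (((X 4).inv_one_add.mul (D 1)).mul (D 2)).mul (D 3)

lemma hasRationalExpansion_vwpRatio : HasRationalExpansion 1 vwpRatio := by
  have X (j : Fin 5) := HasRationalExpansion.coord j
  have N (j : Fin 5) : HasRationalExpansion 1 fun x : Fin 5 → ℂ => 1 + (x j + x 4) := by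
    simpa using (HasRationalExpansion.const 1).add ((X j).add (X 4))
  simpa using! ((((N 0).mul (N 1)).mul (N 2)).mul (N 3)).mul hasRationalExpansion_vwpDenominator

lemma hasRationalExpansion_vwpOuter : HasRationalExpansion 2 vwpOuter := by
  have X (j : Fin 5) := HasRationalExpansion.coord j
  simpa using! ((HasRationalExpansion.const 2).add ((X 0).add
    ((HasRationalExpansion.const 2).mul (X 4)))).mul hasRationalExpansion_vwpDenominator

lemma rising_eq_prod (z : ℂ) (n : ℕ) : rising z n = ∏ m ∈ Finset.range n, (z + m) := by
  induction n with
  | zero => simp [rising]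
  | succ n ih =>
    rw [Finset.prod_range_succ, ← ih, rising, rising, ascPochhammer_succ_eval]

lemma rising_add_one (z : ℂ) (n : ℕ) : rising (z + 1) n =
    n.factorial * ∏ m ∈ Finset.range n, (1 + ((1 / ((m : ℝ) + 1) : ℝ) : ℂ) * z) := by
  rw [rising_eq_prod, ← Finset.prod_range_add_one_eq_factorial, Nat.cast_prod,
    ← Finset.prod_mul_distrib]
  refine Finset.prod_congr rfl fun m _ => ?_
  have : (m : ℂ) + 1 ≠ 0 := m.cast_add_one_ne_zero
  push_cast
  field_simp
  ring

lemma vwpRatio_smul (t : ℂ) (x : Fin 5 → ℂ) : vwpRatio (fun j => t * x j) =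
    (1 + t * (x 0 + x 4)) * (1 + t * (x 1 + x 4)) * (1 + t * (x 2 + x 4)) *
      (1 + t * (x 3 + x 4)) * ((1 + t * x 4)⁻¹ * (1 + t * (x 0 - x 1 + x 4))⁻¹ *
      (1 + t * (x 0 - x 2 + x 4))⁻¹ * (1 + t * (x 0 - x 3 + x 4))⁻¹) := by
  simp only [vwpRatio, ← mul_add, ← mul_sub]

lemma vwpOuter_smul (t : ℂ) (x : Fin 5 → ℂ) : vwpOuter (fun j => t * x j) =
    (2 + t * (x 0 + 2 * x 4)) * ((1 + t * x 4)⁻¹ * (1 + t * (x 0 - x 1 + x 4))⁻¹ *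
      (1 + t * (x 0 - x 2 + x 4))⁻¹ * (1 + t * (x 0 - x 3 + x 4))⁻¹) := by
  simp only [vwpOuter, mul_left_comm (2 : ℂ) t, ← mul_add, ← mul_sub]

/-- Here M = n + 1 and N = n!: the numerator carries M N⁴ and the denominator (M N)⁴, which leaves
M⁻³. No condition on the `Q`'s and `d`'s is needed, since inversion is multiplicative even at 0. -/
lemma vwp_cancel {M N : ℂ} (hM : M ≠ 0) (hN : N ≠ 0)
    (O P₁ P₂ P₃ P₄ Q₁ Q₂ Q₃ Q₄ d₁ d₂ d₃ d₄ : ℂ) :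
    M * O * (N * P₁) * (N * P₂) * (N * P₃) * (N * P₄) / (M * N * (Q₁ * d₁) *
      (M * N * (Q₂ * d₂)) * (M * N * (Q₃ * d₃)) * (M * N * (Q₄ * d₄))) =
    1 / M ^ 3 * (O * (d₁⁻¹ * d₂⁻¹ * d₃⁻¹ * d₄⁻¹) *
      (P₁ * P₂ * P₃ * P₄ * (Q₁⁻¹ * Q₂⁻¹ * Q₃⁻¹ * Q₄⁻¹))) := by
  have h : M * N ^ 4 * (M * N * (M * N) * (M * N) * (M * N))⁻¹ = 1 / M ^ 3 := by field_simp
  rw [← h, div_eq_mul_inv]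
  simp only [mul_inv]
  ring

lemma vwpTerm_eq_nestedTerm (x : Fin 5 → ℂ) (n : ℕ) :
    vwpTerm x n = nestedTerm vwpRatio vwpOuter x n := by
  have hM : (n : ℂ) + 1 ≠ 0 := n.cast_add_one_ne_zero
  have hN : (n.factorial : ℂ) ≠ 0 := by exact_mod_cast n.factorial_ne_zero
  have hout : x 0 + 2 * x 4 + 2 * n + 2 =
      ((n : ℂ) + 1) * (2 + ((1 / ((n : ℝ) + 1) : ℝ) : ℂ) * (x 0 + 2 * x 4)) := by
    push_cast
    field_simp
    ring
  have hq : ((1 / ((n : ℚ) + 1) ^ 3 : ℚ) : ℂ) = 1 / ((n : ℂ) + 1) ^ 3 := by push_cast; rfl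
  simp only [vwpTerm, vwpNum, vwpDen, nestedTerm, vwpRatio_smul, vwpOuter_smul, hout, hq,
    rising_add_one, Finset.prod_range_succ, Nat.factorial_succ, Finset.prod_mul_distrib,
    Finset.prod_inv_distrib, Nat.cast_mul, Nat.cast_succ]
  exact vwp_cancel hM hN _ _ _ _ _ _ _ _ _ _ _ _ _

lemma rising_ne_zero {z : ℂ} (hz : ‖z‖ < 1) (n : ℕ) : rising (z + 1) n ≠ 0 := by
  rw [rising_eq_prod, Finset.prod_ne_zero_iff]
  intro m _ h0
  have h1 : z = -((m + 1 : ℕ) : ℂ) := by push_cast; linear_combination h0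
  rw [h1, norm_neg, Complex.norm_natCast] at hz
  have : (1 : ℝ) ≤ ((m + 1 : ℕ) : ℝ) := by exact_mod_cast Nat.succ_pos m
  linarith

lemma vwpDen_ne_zero {x : Fin 5 → ℂ} (hx : ‖x‖ < 1 / 3) (k : ℕ) :
    vwpDen (x 0) (x 1) (x 2) (x 3) (x 4) k ≠ 0 := by
  have hj : ∀ j, ‖x j‖ < 1 / 3 := fun j => (norm_le_pi_norm x j).trans_lt hx
  -- Three coordinates occur, whence the radius 1/3.
  have hd : ∀ j, ‖x 0 - x j + x 4‖ < 1 := fun j => by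
    have h1 := norm_add_le (x 0 - x j) (x 4)
    have h2 := norm_sub_le (x 0) (x j)
    linarith [hj 0, hj j, hj 4]
  unfold vwpDen
  exact mul_ne_zero (mul_ne_zero (mul_ne_zero (rising_ne_zero (by linarith [hj 4]) _)
    (rising_ne_zero (hd 1) _)) (rising_ne_zero (hd 2) _)) (rising_ne_zero (hd 3) _)

theorem mainTheorem8 :
    (∀ᶠ x in 𝓝 (0 : Fin 5 → ℂ),
      (∀ k : ℕ, vwpDen (x 0) (x 1) (x 2) (x 3) (x 4) k ≠ 0) ∧ Summable (vwpTerm x)) ∧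
    AnalyticAt ℂ vwpSeries 0 ∧
    (∃ c : (Fin 5 → ℕ) → ℂ, IsPowerSeriesExpansion vwpSeries c) ∧
    (∀ c : (Fin 5 → ℕ) → ℂ, IsPowerSeriesExpansion vwpSeries c →
      ∀ i : Fin 5 → ℕ, ∃ r ∈ mzvSpan (3 + ∑ j, i j), c i = (r : ℂ)) := by
  obtain ⟨r, hr, B, φ, hφ, hsum, hmzv⟩ := exists_expandsOn_tsum_nestedTerm
    hasRationalExpansion_vwpRatio hasRationalExpansion_vwpOuter
  have hterm : ∀ x, vwpTerm x = nestedTerm vwpRatio vwpOuter x :=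
    fun x => funext (vwpTerm_eq_nestedTerm x)
  have hf : ExpandsOn r B φ vwpSeries :=
    hφ.congr_fun fun x _ => by rw [vwpSeries, hterm]
  refine ⟨?_, hf.analyticAt hr, ⟨_, isPowerSeriesExpansion_of_expandsOn hr hf⟩,
    fun c hc i => ?_⟩
  · filter_upwards [Metric.ball_mem_nhds (0 : Fin 5 → ℂ) hr,
      Metric.ball_mem_nhds (0 : Fin 5 → ℂ) (by norm_num : (0 : ℝ) < 1 / 3)] with x hx hx'
    rw [mem_ball_zero_iff] at hx hx'
    refine ⟨vwpDen_ne_zero hx', ?_⟩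
    rw [hterm]
    exact hsum x fun j => (norm_le_pi_norm x j).trans hx.le
  · obtain ⟨r', hr', B', hc'⟩ := hc.exists_expandsOn
    obtain ⟨s, hs, hcs⟩ := hmzv (Finsupp.equivFunOnFinite.symm i)
    -- Any admissible coefficient family coincides with the one constructed from the nested series.
    rw [hf.unique hr hr' hc'] at hcs
    refine ⟨s, ?_, hcs⟩
    simpa [Finsupp.degree_eq_sum] using hs
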